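/- Let $dA=\pi^{-1}\,dx\,dy$ be the normalized area measure on $\mathbb C$. Let $Q:\mathbb C\to\mathbb R$ be $C^2$-smooth and suppose that for some $\epsilon,R>0$ we have $Q(z)\ge(1+\epsilon)\log|z|^2$ for all $|z|\ge R$. Let $\widehat Q$ be the equilibrium weight, i.e. the largest subharmonic function in $\mathbb C$ that is $\le Q$ everywhere and satisfies $\widehat Q(z)=\log|z|^2+O(1)$ as $|z|\to\infty$ (the pointwise supremum of all such minorants of $Q$), and let $\mathcal S=\{z: Q(z)=\widehat Q(z)\}$. For real $m\ge 1$ and an integer $n\ge 0$, let $A^2_{2,mQ,n}$ be the space of all $u\in\operatorname{span}_{\mathbb C}\{\bar z^r z^j: 0\le r\le 1,\ 0\le j\le n-1\}$ with $\|u\|_{mQ}^2:=\int_{\mathbb C}|u|^2e^{-mQ}\,dA<\infty$, and let $K_{2,mQ,n}(z,w)=\sum_j e_j(z)\overline{e_j(w)}$ be its reproducing kernel, where $(e_j)$ is any orthonormal basis of $A^2_{2,mQ,n}$ in $L^2(e^{-mQ}dA)$. Then there is a constant $C>0$ depending only on $Q$ such that for all real $m\ge1$ and all integers $0\le n\le m$: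 (i) for all $u\in A^2_{2,mQ,n}$ and all $z\in\mathbb C$, $$|u(z)|^2\le C m^2\,\|u\|_{mQ}^2\,e^{m\widehat Q(z)};$$ (ii) for all $z\in\mathbb C$, $$K_{2,mQ,n}(z,z)\,e^{-mQ(z)}\le C m^2\,e^{-m(Q(z)-\widehat Q(z))}.$$ Consequently, the one-point function decays exponentially off $\mathcal S$: for every $z\in\mathbb C\setminus\mathcal S$ there are $c,C'>0$, depending only on $Q$ and $z$, such that $K_{2,mQ,n}(z,z)e^{-mQ(z)}\le C'e^{-cm}$ for all real $m\ge1$ and all integers $0\le n\le m$. -/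

import Mathlib

namespace Polyanalytic

open MeasureTheory ComplexConjugate

/-- A growth condition on the weight:
`Q(z) ≥ (1 + ε) log |z|²` for `|z| ≥ R`, for some positive `ε` and `R`. -/
def WeightGrowth (Q : ℂ → ℝ) : Prop :=
  ∃ ε : ℝ, 0 < ε ∧ ∃ R : ℝ, 0 < R ∧
    ∀ z : ℂ, R ≤ ‖z‖ → (1 + ε) * Real.log (‖z‖ ^ 2) ≤ Q z

/-- A real-valued subharmonic function in the plane: upper semicontinuous, with the
sub-mean value inequality on all circles. (For a finite-valued subharmonic function the means over
circles are finite; the integrability clause records this, so that the mean is a genuine one.) -/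
def IsSubharmonic (v : ℂ → ℝ) : Prop :=
  UpperSemicontinuous v ∧
    ∀ (z : ℂ) (r : ℝ), 0 < r → CircleIntegrable v z r ∧ v z ≤ Real.circleAverage v z r

/-- `v(z) = log |z|² + O(1)` as `|z| → ∞`. -/
def HasLogGrowth (v : ℂ → ℝ) : Prop :=
  (fun z : ℂ => v z - Real.log (‖z‖ ^ 2)) =O[Bornology.cobounded ℂ] (fun _ => (1 : ℝ))

/-- The competitors for the equilibrium weight: the subharmonic functions in the plane that are
`≤ Q` everywhere and equal to `log |z|² + O(1)` at infinity. -/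
def subharmonicMinorants (Q : ℂ → ℝ) : Set (ℂ → ℝ) :=
  {v | IsSubharmonic v ∧ (∀ z, v z ≤ Q z) ∧ HasLogGrowth v}

/-- The equilibrium weight `Q̂`: the upper envelope of the competitors. The largest competitor
is this function, see `equilibriumWeight_eq_of_isGreatest`. -/
noncomputable def equilibriumWeight (Q : ℂ → ℝ) (z : ℂ) : ℝ :=
  sSup ((fun v : ℂ → ℝ => v z) '' subharmonicMinorants Q)

theorem equilibriumWeight_eq_of_isGreatest {Q v : ℂ → ℝ}
    (hv : IsGreatest (subharmonicMinorants Q) v) : v = equilibriumWeight Q := by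
  funext z
  have h : IsGreatest ((fun v : ℂ → ℝ => v z) '' subharmonicMinorants Q) (v z) := by
    refine ⟨⟨v, hv.1, rfl⟩, ?_⟩
    rintro _ ⟨w, hw, rfl⟩
    exact hv.2 hw z
  exact h.csSup_eq.symm

/-- The coincidence set (droplet) `S = {Q = Q̂}`. -/
def droplet (Q : ℂ → ℝ) : Set ℂ := {z | Q z = equilibriumWeight Q z}

/-- The measure `e^{-mQ} dA`, where `dA = π⁻¹ dx dy`. -/
noncomputable def weightedMeasure (Q : ℂ → ℝ) (m : ℝ) : Measure ℂ :=
  (ENNReal.ofReal Real.pi⁻¹ • (volume : Measure ℂ)).withDensity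
    (fun z => ENNReal.ofReal (Real.exp (-(m * Q z))))

/-- `‖u‖²_{mQ} = ∫ |u|² e^{-mQ} dA`. -/
noncomputable def weightedNormSq (Q : ℂ → ℝ) (m : ℝ) (u : ℂ → ℂ) : ℝ :=
  ∫ z, ‖u z‖ ^ 2 ∂weightedMeasure Q m

/-- The inner product `∫ u v̄ e^{-mQ} dA` of `L²(e^{-mQ})`. -/
noncomputable def weightedInner (Q : ℂ → ℝ) (m : ℝ) (u v : ℂ → ℂ) : ℂ :=
  ∫ z, u z * conj (v z) ∂weightedMeasure Q m

/-- `Pol_{q,n}`: the complex span of `z̄ ^ r z ^ j`, `0 ≤ r ≤ q - 1`, `0 ≤ j ≤ n - 1`. -/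
def Pol (q n : ℕ) : Submodule ℂ (ℂ → ℂ) :=
  Submodule.span ℂ {f | ∃ r < q, ∃ j < n, f = fun z : ℂ => conj z ^ r * z ^ j}

/-- `A²_{q,mQ,n} = Pol_{q,n} ∩ L²(e^{-mQ})`. -/
noncomputable def A2 (q : ℕ) (Q : ℂ → ℝ) (m : ℝ) (n : ℕ) : Submodule ℂ (ℂ → ℂ) where
  carrier := {u | u ∈ Pol q n ∧ MemLp u 2 (weightedMeasure Q m)}
  add_mem' hu hv := ⟨add_mem hu.1 hv.1, hu.2.add hv.2⟩
  zero_mem' := ⟨zero_mem _, MemLp.zero⟩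
  smul_mem' c _ hu := ⟨Submodule.smul_mem _ c hu.1, hu.2.const_smul c⟩

/-- `e` is an orthonormal basis of `A²_{q,mQ,n}`. -/
def IsOrthonormalBasis (q : ℕ) (Q : ℂ → ℝ) (m : ℝ) (n : ℕ) {d : ℕ} (e : Fin d → ℂ → ℂ) : Prop :=
  Submodule.span ℂ (Set.range e) = A2 q Q m n ∧
    ∀ i j, weightedInner Q m (e i) (e j) = if i = j then 1 else 0

open scoped Classical in
/-- The reproducing kernel `K_{q,mQ,n}(z,w) = ∑ e_j(z) conj (e_j(w))`, where `(e_j)` is an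
orthonormal basis of `A²_{q,mQ,n}`. For continuous `Q` such a basis exists, and the kernel does not
depend on it: `exists_isOrthonormalBasis`, `bergmanKernel_eq`. -/
noncomputable def bergmanKernel (q : ℕ) (Q : ℂ → ℝ) (m : ℝ) (n : ℕ) (z w : ℂ) : ℂ :=
  if h : ∃ (d : ℕ) (e : Fin d → ℂ → ℂ), IsOrthonormalBasis q Q m n e then
    ∑ j, h.choose_spec.choose j z * conj (h.choose_spec.choose j w)
  else 0

/-- The one-point function `Γ¹_{q,mQ,n}(z) = K_{q,mQ,n}(z,z) e^{-mQ(z)}`; the diagonal values of the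
kernel are real and non-negative, see `bergmanKernel_self`. -/
noncomputable def onePointFunction (q : ℕ) (Q : ℂ → ℝ) (m : ℝ) (n : ℕ) (z : ℂ) : ℝ :=
  (bergmanKernel q Q m n z z).re * Real.exp (-(m * Q z))

theorem continuous_of_mem_Pol {q n : ℕ} {u : ℂ → ℂ} (hu : u ∈ Pol q n) : Continuous u := by
  induction hu using Submodule.span_induction with
  | mem f hf =>
    obtain ⟨r, _, j, _, rfl⟩ := hf
    fun_prop
  | zero => exact continuous_const
  | add f g _ _ hf hg => exact hf.add hg
  | smul c f _ hf => exact hf.const_smul c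

instance finiteDimensional_Pol (q n : ℕ) : FiniteDimensional ℂ (Pol q n) := by
  refine FiniteDimensional.span_of_finite ℂ ?_
  refine ((Set.finite_Iio q).image2 (fun r j => fun z : ℂ => conj z ^ r * z ^ j)
    (Set.finite_Iio n)).subset ?_
  rintro f ⟨r, hr, j, hj, rfl⟩
  exact ⟨r, hr, j, hj, rfl⟩

theorem A2_le_Pol (q : ℕ) (Q : ℂ → ℝ) (m : ℝ) (n : ℕ) : A2 q Q m n ≤ Pol q n := fun _ h => h.1

instance finiteDimensional_A2 (q : ℕ) (Q : ℂ → ℝ) (m : ℝ) (n : ℕ) :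
    FiniteDimensional ℂ (A2 q Q m n) :=
  Submodule.finiteDimensional_of_le (A2_le_Pol q Q m n)

theorem integrable_inner {Q : ℂ → ℝ} {m : ℝ} {u v : ℂ → ℂ}
    (hu : MemLp u 2 (weightedMeasure Q m)) (hv : MemLp v 2 (weightedMeasure Q m)) :
    Integrable (fun z => u z * conj (v z)) (weightedMeasure Q m) :=
  hu.integrable_mul hv.star

theorem ae_volume_of_ae {Q : ℂ → ℝ} (hQ : Continuous Q) {m : ℝ} {p : ℂ → Prop}
    (h : ∀ᵐ z ∂weightedMeasure Q m, p z) : ∀ᵐ z, p z := by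
  have h1 : (volume : Measure ℂ) ≪ ENNReal.ofReal Real.pi⁻¹ • (volume : Measure ℂ) := by
    refine Measure.absolutelyContinuous_smul ?_
    simpa using Real.pi_pos
  have h2 : ENNReal.ofReal Real.pi⁻¹ • (volume : Measure ℂ) ≪ weightedMeasure Q m := by
    refine withDensity_absolutelyContinuous' ?_ ?_
    · exact Measurable.aemeasurable (by fun_prop)
    · exact Filter.Eventually.of_forall fun z => by simpa using Real.exp_pos _
  exact (h1.trans h2).ae_le h

theorem eq_zero_of_weightedInner_self {q : ℕ} {Q : ℂ → ℝ} (hQ : Continuous Q) {m : ℝ} {n : ℕ}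
    {u : ℂ → ℂ} (hu : u ∈ A2 q Q m n) (h : weightedInner Q m u u = 0) : u = 0 := by
  have hi := integrable_inner hu.2 hu.2
  have h0 : ∫ z, ‖u z‖ ^ 2 ∂weightedMeasure Q m = 0 := by
    have : weightedInner Q m u u = ((∫ z, ‖u z‖ ^ 2 ∂weightedMeasure Q m : ℝ) : ℂ) := by
      rw [weightedInner, ← integral_complex_ofReal]
      congr 1; ext z; rw [Complex.mul_conj']; push_cast; rfl
    rw [this] at h; exact_mod_cast h
  rw [integral_eq_zero_iff_of_nonneg (fun z => by positivity) (by simpa using hu.2.integrable_norm_pow two_ne_zero)] at h0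
  have h1 : u =ᵐ[volume] 0 := by
    refine ae_volume_of_ae hQ (h0.mono fun z hz => ?_)
    simpa using hz
  exact (continuous_of_mem_Pol hu.1).ae_eq_iff_eq volume continuous_const |>.1 h1

theorem exists_isOrthonormalBasis (q : ℕ) {Q : ℂ → ℝ} (hQ : Continuous Q) (m : ℝ) (n : ℕ) :
    ∃ (d : ℕ) (e : Fin d → ℂ → ℂ), IsOrthonormalBasis q Q m n e := by
  let core : InnerProductSpace.Core ℂ (A2 q Q m n) :=
    { inner := fun u v => weightedInner Q m v u
      conj_inner_symm := fun u v => by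
        simp only [weightedInner, ← integral_conj]
        congr 1; ext z; simp [mul_comm]
      re_inner_nonneg := fun u => by
        have : weightedInner Q m u u
            = ((∫ z, ‖(u : ℂ → ℂ) z‖ ^ 2 ∂weightedMeasure Q m : ℝ) : ℂ) := by
          rw [weightedInner, ← integral_complex_ofReal]
          congr 1; ext z; rw [Complex.mul_conj']; push_cast; rfl
        rw [this]
        simpa using integral_nonneg fun z => by positivity
      add_left := fun u v w => by
        simp only [weightedInner]
        rw [← integral_add (integrable_inner w.2.2 u.2.2) (integrable_inner w.2.2 v.2.2)]
        congr 1; ext z; simp [mul_add]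
      smul_left := fun u v c => by
        simp only [weightedInner]
        rw [← integral_const_mul]
        congr 1; ext z; simp; ring
      definite := fun u hu => Subtype.ext (eq_zero_of_weightedInner_self hQ u.2 hu) }
  let _ : NormedAddCommGroup (A2 q Q m n) := core.toNormedAddCommGroup
  let _ : InnerProductSpace ℂ (A2 q Q m n) := InnerProductSpace.ofCore core.toCore
  let b := stdOrthonormalBasis ℂ (A2 q Q m n)
  refine ⟨_, fun i => (b i : ℂ → ℂ), ?_, fun i j => ?_⟩
  · have h := congrArg (Submodule.map (A2 q Q m n).subtype) b.toBasis.span_eq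
    rw [Submodule.map_span, Submodule.map_top, Submodule.range_subtype, ← Set.range_comp] at h
    refine Eq.trans ?_ h
    congr 2
  · have h := orthonormal_iff_ite.1 b.orthonormal j i
    rw [show (if i = j then (1 : ℂ) else 0) = if j = i then 1 else 0 by simp [eq_comm]]
    exact h

theorem IsOrthonormalBasis.mem {q : ℕ} {Q : ℂ → ℝ} {m : ℝ} {n d : ℕ} {e : Fin d → ℂ → ℂ}
    (he : IsOrthonormalBasis q Q m n e) (i : Fin d) : e i ∈ A2 q Q m n :=
  he.1 ▸ Submodule.subset_span ⟨i, rfl⟩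

theorem IsOrthonormalBasis.expand {q : ℕ} {Q : ℂ → ℝ} {m : ℝ} {n d : ℕ} {e : Fin d → ℂ → ℂ}
    (he : IsOrthonormalBasis q Q m n e) {u : ℂ → ℂ} (hu : u ∈ A2 q Q m n) :
    u = ∑ i, weightedInner Q m u (e i) • e i := by
  rw [← he.1, Submodule.mem_span_range_iff_exists_fun] at hu
  obtain ⟨c, rfl⟩ := hu
  refine Finset.sum_congr rfl fun i _ => ?_
  congr 1
  have : weightedInner Q m (∑ j, c j • e j) (e i) = ∑ j, c j * weightedInner Q m (e j) (e i) := by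
    simp only [weightedInner, ← integral_const_mul]
    rw [← integral_finsetSum _
      fun j _ => (integrable_inner (he.mem j).2 (he.mem i).2).const_mul _]
    congr 1; ext z; simp [Finset.sum_mul, mul_assoc]
  simp [this, he.2]

theorem weightedInner_conj (Q : ℂ → ℝ) (m : ℝ) (u v : ℂ → ℂ) :
    conj (weightedInner Q m u v) = weightedInner Q m v u := by
  simp only [weightedInner, ← integral_conj]
  congr 1; ext z; simp [mul_comm]

/-- The kernel does not depend on the choice of the orthonormal basis. -/
theorem bergmanKernel_eq {q : ℕ} {Q : ℂ → ℝ} {m : ℝ} {n d : ℕ} {e : Fin d → ℂ → ℂ}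
    (he : IsOrthonormalBasis q Q m n e) (z w : ℂ) :
    bergmanKernel q Q m n z w = ∑ j, e j z * conj (e j w) := by
  have h : ∃ (d : ℕ) (e : Fin d → ℂ → ℂ), IsOrthonormalBasis q Q m n e := ⟨d, e, he⟩
  rw [bergmanKernel, dif_pos h]
  have hf : IsOrthonormalBasis q Q m n h.choose_spec.choose := h.choose_spec.choose_spec
  generalize h.choose_spec.choose = f at hf
  have h1 : ∀ i, f i z = ∑ j, weightedInner Q m (f i) (e j) * e j z := fun i => by
    simpa using congrFun (he.expand (hf.mem i)) z
  have h2 : ∀ j, e j w = ∑ i, weightedInner Q m (e j) (f i) * f i w := fun j => by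
    simpa using congrFun (hf.expand (he.mem j)) w
  simp_rw [h1, Finset.sum_mul]
  rw [Finset.sum_comm]
  refine Finset.sum_congr rfl fun j _ => ?_
  rw [h2 j, map_sum, Finset.mul_sum]
  refine Finset.sum_congr rfl fun i _ => ?_
  rw [map_mul, weightedInner_conj]
  ring

theorem bergmanKernel_self {q : ℕ} {Q : ℂ → ℝ} {m : ℝ} {n d : ℕ} {e : Fin d → ℂ → ℂ}
    (he : IsOrthonormalBasis q Q m n e) (z : ℂ) :
    bergmanKernel q Q m n z z = ((∑ j, ‖e j z‖ ^ 2 : ℝ) : ℂ) := by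
  rw [bergmanKernel_eq he]
  push_cast
  exact Finset.sum_congr rfl fun j _ => Complex.mul_conj' _

end Polyanalytic

/-!
Suppose the weight is touched from above at `c` by the paraboloid
`Q c + re (a * (z - c)) + A * ‖z - c‖ ^ 2`. On the disc of radius `1 / √m` about `c`, the squared
modulus of the holomorphic factor `exp (-(m / 2) * a * (z - c))` is then at most
`exp A * exp (m * (Q c - Q z))`. Mean values over this disc of the bianalytic function
`u = F + conj z * G` times the factor bound `‖u c‖ ^ 2` by `m * ‖u‖ ^ 2 * exp (m * Q c)` and
`‖G c‖ ^ 2` by `m ^ 2 * ‖u‖ ^ 2 * exp (m * Q c)`, up to constants.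

Passing from `Q` to the equilibrium weight requires `log ‖u‖` to be subharmonic, which may fail.
For each `a`, however, freezing `conj z` at `conj a` gives a polynomial of degree less than `n` that
agrees with `u` at `a`, and `F + conj a * G = u - (conj z - conj a) * G` is controlled by the two
local bounds. Multiplied by `(1 + conj a * z) / (1 + ‖a‖ ^ 2)`, it is controlled uniformly in `a`.
If a polynomial `p` of degree at most `m` satisfies `‖p‖ ^ 2 ≤ M * exp (m * Q)` on a large disc,
then `m⁻¹ * log (‖p‖ ^ 2 / M)`, suitably truncated, competes in the definition of the equilibrium
weight, so the bound holds everywhere with `Q` replaced by the equilibrium weight.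

The kernel bound follows since `K(z, z)` is the largest value of `‖u z‖ ^ 2` over the unit ball.
-/

namespace Polyanalytic

/-! ### Local semiconcavity -/

section

open Metric

/-- Local semiconcavity: at every point the function is touched from above by a paraboloid over the
unit ball, with an opening that is uniform on bounded sets. This is the only regularity of the
weight that the pointwise estimates use. -/
def IsLocallySemiconcave {E : Type*} [NormedAddCommGroup E] [NormedSpace ℝ E] (Q : E → ℝ) : Prop :=
  ∀ R : ℝ, ∃ A : ℝ, 0 ≤ A ∧ ∀ c : E, ‖c‖ ≤ R → ∃ l : E →L[ℝ] ℝ, ∀ z : E, ‖z - c‖ ≤ 1 →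
    Q z ≤ Q c + l (z - c) + A * ‖z - c‖ ^ 2

theorem norm_sub_sub_fderiv_le_of_lipschitzOnWith {E F : Type*} [NormedAddCommGroup E]
    [NormedSpace ℝ E] [NormedAddCommGroup F] [NormedSpace ℝ F] {f : E → F}
    (hf : Differentiable ℝ f) {s : Set E} {K : NNReal} (hK : LipschitzOnWith K (fderiv ℝ f) s)
    {c z : E} (hs : closedBall c ‖z - c‖ ⊆ s) :
    ‖f z - f c - fderiv ℝ f c (z - c)‖ ≤ K * ‖z - c‖ ^ 2 := by
  have hc : c ∈ closedBall c ‖z - c‖ := mem_closedBall_self (norm_nonneg _)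
  rw [sq, ← mul_assoc]
  refine (convex_closedBall c ‖z - c‖).norm_image_sub_le_of_norm_hasFDerivWithin_le'
    (fun w _ => (hf w).hasFDerivAt.hasFDerivWithinAt) (fun w hw => ?_) hc
    (mem_closedBall_iff_norm.2 le_rfl)
  exact (hK.norm_sub_le (hs hw) (hs hc)).trans
    (mul_le_mul_of_nonneg_left (mem_closedBall_iff_norm.1 hw) K.2)

theorem isLocallySemiconcave_of_contDiff {E : Type*} [NormedAddCommGroup E] [NormedSpace ℝ E]
    [ProperSpace E] {Q : E → ℝ} (hQ : ContDiff ℝ 2 Q) : IsLocallySemiconcave Q := by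
  intro R
  obtain ⟨K, hK⟩ := (hQ.fderiv_right (m := 1) (by norm_num)).contDiffOn.exists_lipschitzOnWith
    one_ne_zero (convex_closedBall (0 : E) (R + 1)) (isCompact_closedBall _ _)
  refine ⟨K, K.2, fun c hc => ⟨fderiv ℝ Q c, fun z hz => ?_⟩⟩
  have hball : closedBall c ‖z - c‖ ⊆ closedBall 0 (R + 1) :=
    closedBall_subset_closedBall' (by rw [dist_zero_right]; linarith)
  have htaylor := (le_abs_self _).trans (norm_sub_sub_fderiv_le_of_lipschitzOnWith
    (hQ.differentiable two_ne_zero) hK hball)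
  linarith

theorem IsLocallySemiconcave.exists_concaveOn_sub_norm_sq {E : Type*} [NormedAddCommGroup E]
    [InnerProductSpace ℝ E] {Q : E → ℝ} (hQ : IsLocallySemiconcave Q) (c : E) :
    ∃ A : ℝ, ConcaveOn ℝ (ball c (1 / 2)) fun z => Q z - A * ‖z‖ ^ 2 := by
  obtain ⟨A, -, hA⟩ := hQ (‖c‖ + 1 / 2)
  refine ⟨A, convex_ball c _, fun z hz w hw a b ha hb hab => ?_⟩
  set p : E := a • z + b • w
  have hp : p ∈ ball c (1 / 2) := convex_ball c _ hz hw ha hb hab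
  have hnear {x : E} (hx : x ∈ ball c (1 / 2)) : ‖x - p‖ ≤ 1 := by
    rw [← dist_eq_norm]
    linarith [dist_triangle_right x p c, mem_ball.1 hx, mem_ball.1 hp]
  obtain ⟨l, hl⟩ := hA p (by
    linarith [norm_le_norm_add_norm_sub' p c, dist_eq_norm p c, mem_ball.1 hp])
  have hbary : a * l (z - p) + b * l (w - p) = 0 := by
    rw [map_sub, map_sub, show l p = a * l z + b * l w by simp [p]]
    linear_combination (-(a * l z + b * l w)) * hab
  have hsq : a * ‖z - p‖ ^ 2 + b * ‖w - p‖ ^ 2 = a * ‖z‖ ^ 2 + b * ‖w‖ ^ 2 - ‖p‖ ^ 2 := by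
    have hinner : a * inner ℝ z p + b * inner ℝ w p = ‖p‖ ^ 2 := by
      rw [← real_inner_self_eq_norm_sq, ← real_inner_smul_left, ← real_inner_smul_left,
        ← inner_add_left]
    rw [norm_sub_sq_real, norm_sub_sq_real]
    linear_combination ‖p‖ ^ 2 * hab - 2 * hinner
  have hz' := mul_le_mul_of_nonneg_left (hl z (hnear hz)) ha
  have hw' := mul_le_mul_of_nonneg_left (hl w (hnear hw)) hb
  simp only [smul_eq_mul]
  linear_combination hz' + hw' + Q p * hab + hbary + A * hsq

theorem IsLocallySemiconcave.continuous {E : Type*} [NormedAddCommGroup E]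
    [InnerProductSpace ℝ E] [FiniteDimensional ℝ E] {Q : E → ℝ} (hQ : IsLocallySemiconcave Q) :
    Continuous Q := by
  refine continuous_iff_continuousAt.2 fun c => ?_
  obtain ⟨A, hA⟩ := hQ.exists_concaveOn_sub_norm_sq c
  have h := (hA.continuousOn isOpen_ball).continuousAt (ball_mem_nhds c (by norm_num))
  have hsq : Continuous fun z : E => A * ‖z‖ ^ 2 := by fun_prop
  exact (h.add hsq.continuousAt).congr (.of_forall fun z => sub_add_cancel (Q z) _)

end

/-! ### Subharmonic functions -/

section

open Metric Real

theorem log_norm_le_circleAverage {f : ℂ → ℂ} {c : ℂ} {R : ℝ}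
    (hf : AnalyticOnNhd ℂ f (closedBall c |R|)) (hc : f c ≠ 0) :
    log ‖f c‖ ≤ circleAverage (log ‖f ·‖) c R := by
  rcases eq_or_ne R 0 with rfl | hR
  · simp
  rw [hf.circleAverage_log_norm hR hc]
  refine le_add_of_nonneg_left (finsum_nonneg fun u => ?_)
  by_cases hu : u ∈ closedBall c |R|
  · refine mul_nonneg (mod_cast MeromorphicOn.AnalyticOnNhd.divisor_nonneg hf u) ?_
    rcases eq_or_ne u c with rfl | huc
    · simp
    rw [← log_abs, abs_mul, abs_inv, abs_norm, ← div_eq_mul_inv]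
    refine log_nonneg ((one_le_div₀ (norm_pos_iff.2 (sub_ne_zero.2 huc.symm))).2 ?_)
    rwa [← dist_eq_norm, dist_comm]
  · simp [hu]

theorem isSubharmonic_posLog_norm {f : ℂ → ℂ} (hf : Differentiable ℂ f) :
    IsSubharmonic fun z => log⁺ ‖f z‖ := by
  have hcont : Continuous fun z => log⁺ ‖f z‖ := continuous_posLog.comp hf.continuous.norm
  refine ⟨hcont.upperSemicontinuous, fun c r _ => ?_⟩
  have hint : CircleIntegrable (fun z => log⁺ ‖f z‖) c r := hcont.continuousOn.circleIntegrable'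
  refine ⟨hint, max_le (circleAverage_nonneg_of_nonneg fun z _ => posLog_nonneg) ?_⟩
  rcases eq_or_ne (f c) 0 with hc | hc
  · simpa [hc] using circleAverage_nonneg_of_nonneg fun z _ => posLog_nonneg (x := ‖f z‖)
  have hana : AnalyticOnNhd ℂ f Set.univ := fun z _ => hf.analyticAt z
  exact (log_norm_le_circleAverage (hana.mono (Set.subset_univ _)) hc).trans (circleAverage_mono
    (hana.mono (Set.subset_univ _)).meromorphicOn.circleIntegrable_log_norm hint
    fun z _ => le_max_right _ _)

theorem IsSubharmonic.max {v w : ℂ → ℝ} (hv : IsSubharmonic v) (hw : IsSubharmonic w) :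
    IsSubharmonic fun z => max (v z) (w z) := by
  refine ⟨hv.1.sup hw.1, fun c r hr => ?_⟩
  obtain ⟨hvi, hvc⟩ := hv.2 c r hr
  obtain ⟨hwi, hwc⟩ := hw.2 c r hr
  have hint : CircleIntegrable (fun z => Max.max (v z) (w z)) c r :=
    ⟨hvi.1.sup hwi.1, hvi.2.sup hwi.2⟩
  exact ⟨hint, max_le (hvc.trans (circleAverage_mono hvi hint fun z _ => le_max_left _ _))
    (hwc.trans (circleAverage_mono hwi hint fun z _ => le_max_right _ _))⟩

theorem IsSubharmonic.const_mul_sub_const {v : ℂ → ℝ} (hv : IsSubharmonic v) {a : ℝ} (ha : 0 ≤ a)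
    (b : ℝ) : IsSubharmonic fun z => a * v z - b := by
  have hmono : Monotone fun x : ℝ => a * x - b := fun x y hxy => by dsimp only; gcongr
  refine ⟨Continuous.comp_upperSemicontinuous (g := fun x : ℝ => a * x - b) (by fun_prop) hv.1
    hmono, fun c r hr => ?_⟩
  obtain ⟨hi, hc⟩ := hv.2 c r hr
  have hai : CircleIntegrable (fun z => a * v z) c r := hi.const_smul (a := a)
  refine ⟨hai.sub (circleIntegrable_const b c r), ?_⟩
  have havg : circleAverage (fun z => a * v z - b) c r = a * circleAverage v c r - b := by
    rw [circleAverage_fun_sub hai (circleIntegrable_const b c r), circleAverage_const]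
    exact congrArg (· - b) (circleAverage_fun_smul (a := a) (f := v))
  exact havg ▸ hmono hc

end

/-! ### Polynomials and the equilibrium weight -/

section

open Filter Metric Polynomial Real Topology

theorem WeightGrowth.tendsto_sub_log_atTop {Q : ℂ → ℝ} (hQ : WeightGrowth Q) :
    Tendsto (fun z => Q z - log (‖z‖ ^ 2)) (Bornology.cobounded ℂ) atTop := by
  obtain ⟨ε, hε, R, -, hR⟩ := hQ
  have hlog : Tendsto (fun z : ℂ => ε * log (‖z‖ ^ 2)) (Bornology.cobounded ℂ) atTop :=
    (tendsto_log_atTop.comp ((tendsto_pow_atTop two_ne_zero).comp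
      tendsto_norm_cobounded_atTop)).const_mul_atTop hε
  refine tendsto_atTop_mono' _ ?_ hlog
  filter_upwards [eventually_cobounded_le_norm R] with z hz
  linarith [hR z hz]

theorem exists_posLog_sub_le {Q : ℂ → ℝ} (hQ : Continuous Q)
    (hgrowth : Tendsto (fun z => Q z - log (‖z‖ ^ 2)) (Bornology.cobounded ℂ) atTop) :
    ∃ c : ℝ, ∀ z, log⁺ (‖z‖ ^ 2) - c ≤ Q z := by
  have hcont : Continuous fun z : ℂ => Q z - log⁺ (‖z‖ ^ 2) :=
    hQ.sub (continuous_posLog.comp (continuous_norm.pow 2))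
  obtain ⟨z₀, hz₀⟩ := hcont.exists_forall_le (by
    rw [← cobounded_eq_cocompact]
    refine hgrowth.congr' ?_
    filter_upwards [eventually_cobounded_le_norm (1 : ℝ)] with z hz
    rw [posLog_eq_log (by simpa using hz)])
  exact ⟨-(Q z₀ - log⁺ (‖z₀‖ ^ 2)), fun z => by linarith [hz₀ z]⟩

/-- The competitor for the equilibrium weight that is built from an entire function: the larger of
`m⁻¹ log |f|²`, truncated at the level `-c`, and `log⁺ |z|² - c`, which enforces logarithmic growth
where `f` is small. -/
noncomputable def competitor (f : ℂ → ℂ) (m c : ℝ) (z : ℂ) : ℝ :=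
  max (log⁺ (‖z‖ ^ 2)) (m⁻¹ * log⁺ (‖f z‖ ^ 2 * exp (m * c))) - c

theorem competitor_le_iff {f : ℂ → ℂ} {m c : ℝ} (hm : 0 < m) {z : ℂ} {y : ℝ} :
    competitor f m c z ≤ y ↔ log⁺ (‖z‖ ^ 2) - c ≤ y ∧ ‖f z‖ ^ 2 ≤ exp (m * y) := by
  rw [competitor, sub_le_iff_le_add, max_le_iff, ← sub_le_iff_le_add, and_congr_right_iff]
  intro hy
  have hyc : 0 ≤ y + c := by linarith [posLog_nonneg (x := ‖z‖ ^ 2)]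
  rw [inv_mul_le_iff₀ hm, posLog_eq_log_max_one (by positivity),
    log_le_iff_le_exp (by positivity), max_le_iff,
    and_iff_right (one_le_exp (by positivity)), mul_add, exp_add, mul_le_mul_iff_left₀ (exp_pos _)]

theorem isSubharmonic_competitor {f : ℂ → ℂ} (hf : Differentiable ℂ f) {m : ℝ} (hm : 0 ≤ m)
    (c : ℝ) : IsSubharmonic (competitor f m c) := by
  have hid := isSubharmonic_posLog_norm (differentiable_id (𝕜 := ℂ) (E := ℂ).pow 2)
  have hfm := (isSubharmonic_posLog_norm ((hf.pow 2).mul_const (exp (m * c) : ℂ)))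
  change IsSubharmonic fun z => competitor f m c z
  simpa [competitor, Complex.norm_exp] using
    (hid.max (hfm.const_mul_sub_const (inv_nonneg.2 hm) 0)).const_mul_sub_const zero_le_one c

theorem competitor_mem_subharmonicMinorants {Q : ℂ → ℝ} {f : ℂ → ℂ} (hf : Differentiable ℂ f)
    {m b c : ℝ} (hm : 0 < m) (hc : ∀ z, log⁺ (‖z‖ ^ 2) - c ≤ Q z)
    (hfQ : ∀ z, ‖f z‖ ^ 2 ≤ exp (m * Q z))
    (hgrowth : ∀ z, 1 ≤ ‖z‖ → ‖f z‖ ^ 2 ≤ exp (m * (b + log (‖z‖ ^ 2)))) :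
    competitor f m c ∈ subharmonicMinorants Q := by
  refine ⟨isSubharmonic_competitor hf hm.le c, fun z => (competitor_le_iff hm).2 ⟨hc z, hfQ z⟩,
    Asymptotics.IsBigO.of_bound (max |b| |c|) ?_⟩
  filter_upwards [eventually_cobounded_le_norm (1 : ℝ)] with z hz
  have hposLog : log⁺ (‖z‖ ^ 2) = log (‖z‖ ^ 2) :=
    posLog_eq_log (by simpa using hz)
  have hlower : log (‖z‖ ^ 2) - c ≤ competitor f m c z :=
    hposLog ▸ ((competitor_le_iff hm).1 le_rfl).1
  have hupper : competitor f m c z ≤ max b (-c) + log (‖z‖ ^ 2) := by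
    refine (competitor_le_iff hm).2 ⟨?_, (hgrowth z hz).trans ?_⟩
    · linarith [le_max_right b (-c)]
    · gcongr
      exact le_max_left _ _
  rw [norm_one, mul_one, Real.norm_eq_abs, abs_le]
  constructor
  · linarith [le_abs_self c, le_max_right |b| |c|]
  · linarith [max_le_max (le_abs_self b) (neg_le_abs c)]

theorem le_equilibriumWeight {Q v : ℂ → ℝ} (hv : v ∈ subharmonicMinorants Q) (z : ℂ) :
    v z ≤ equilibriumWeight Q z :=
  le_csSup ⟨Q z, by rintro _ ⟨w, hw, rfl⟩; exact hw.2.1 z⟩ ⟨v, hv, rfl⟩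

theorem equilibriumWeight_le {Q : ℂ → ℝ} {c : ℝ} (hc : ∀ z, log⁺ (‖z‖ ^ 2) - c ≤ Q z) (z : ℂ) :
    equilibriumWeight Q z ≤ Q z := by
  have hzero : competitor 0 1 c ∈ subharmonicMinorants Q :=
    competitor_mem_subharmonicMinorants (b := 0) (differentiable_const 0) one_pos hc
      (fun z => by simpa using (exp_pos _).le) (fun z _ => by simpa using (exp_pos _).le)
  exact csSup_le ⟨_, _, hzero, rfl⟩ (by rintro _ ⟨v, hv, rfl⟩; exact hv.2.1 z)

theorem norm_sq_le_mul_exp_equilibriumWeight {Q : ℂ → ℝ} {f : ℂ → ℂ} (hf : Differentiable ℂ f)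
    {m b c M : ℝ} (hm : 0 < m) (hc : ∀ z, log⁺ (‖z‖ ^ 2) - c ≤ Q z)
    (hfQ : ∀ z, ‖f z‖ ^ 2 ≤ M * exp (m * Q z))
    (hgrowth : ∀ z, 1 ≤ ‖z‖ → ‖f z‖ ^ 2 ≤ M * exp (m * (b + log (‖z‖ ^ 2)))) (z : ℂ) :
    ‖f z‖ ^ 2 ≤ M * exp (m * equilibriumWeight Q z) := by
  have hM : 0 ≤ M := nonneg_of_mul_nonneg_left ((sq_nonneg _).trans (hfQ 0)) (exp_pos _)
  rw [← div_le_iff₀ (exp_pos _)]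
  refine le_of_forall_gt_imp_ge_of_dense fun M' hM' => ?_
  have hM'0 : 0 < M' := hM.trans_lt hM'
  have hnorm (w : ℂ) : ‖((√M')⁻¹ : ℝ) * f w‖ ^ 2 = ‖f w‖ ^ 2 / M' := by
    rw [norm_mul, Complex.norm_real, mul_pow, Real.norm_eq_abs, sq_abs, inv_pow,
      sq_sqrt hM'0.le, inv_mul_eq_div]
  have hscale {w : ℂ} {x : ℝ} (h : ‖f w‖ ^ 2 ≤ M * exp (m * x)) :
      ‖((√M')⁻¹ : ℝ) * f w‖ ^ 2 ≤ exp (m * x) := by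
    rw [hnorm, div_le_iff₀' hM'0]
    exact h.trans (by gcongr)
  have hmem := competitor_mem_subharmonicMinorants (hf.const_mul (((√M')⁻¹ : ℝ) : ℂ)) hm hc
    (fun w => hscale (hfQ w)) (fun w hw => hscale (hgrowth w hw))
  have hle := ((competitor_le_iff hm).1 (le_equilibriumWeight hmem z)).2
  rwa [hnorm, div_le_iff₀' hM'0, ← div_le_iff₀ (exp_pos _)] at hle

theorem norm_eval_le_of_forall_norm_eq {p : ℂ[X]} {n : ℕ} (hn : p.natDegree ≤ n) {r B : ℝ}
    (hr : 0 < r) (hB : ∀ z : ℂ, ‖z‖ = r → ‖p.eval z‖ ≤ B) {z : ℂ} (hz : r ≤ ‖z‖) :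
    ‖p.eval z‖ ≤ B * (‖z‖ / r) ^ n := by
  have hreflect {w : ℂ} (hw : w ≠ 0) : (p.reflect n).eval w⁻¹ * w ^ n = p.eval w := by
    let _ := invertibleOfNonzero hw
    simpa [eval₂_id] using eval₂_reflect_mul_pow (RingHom.id ℂ) w n p hn
  have hz0 : z ≠ 0 := norm_pos_iff.1 (hr.trans_le hz)
  have hmax : ‖(p.reflect n).eval z⁻¹‖ ≤ B / r ^ n := by
    refine Complex.norm_le_of_forall_mem_frontier_norm_le (U := ball 0 r⁻¹)
      (f := fun w => (p.reflect n).eval w) isBounded_ball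
      (p.reflect n).differentiable.diffContOnCl (fun w hw => ?_) ?_
    · rw [frontier_ball _ (inv_ne_zero hr.ne'), mem_sphere_zero_iff_norm] at hw
      have hw' : ‖w⁻¹‖ = r := by rw [norm_inv, hw, inv_inv]
      have h := hreflect (norm_pos_iff.1 (hw' ▸ hr))
      rw [inv_inv] at h
      rw [le_div_iff₀ (by positivity), ← hw', ← norm_pow, ← norm_mul, h]
      exact hB _ hw'
    · rw [closure_ball _ (inv_ne_zero hr.ne'), mem_closedBall_zero_iff, norm_inv]
      exact inv_anti₀ hr hz
  calc ‖p.eval z‖ = ‖(p.reflect n).eval z⁻¹‖ * ‖z‖ ^ n := by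
        rw [← hreflect hz0, norm_mul, norm_pow]
    _ ≤ B / r ^ n * ‖z‖ ^ n := by gcongr
    _ = B * (‖z‖ / r) ^ n := by rw [div_pow]; ring

theorem norm_eval_sq_le_mul_exp {p : ℂ[X]} {m b M : ℝ} (hp : p.natDegree ≤ m)
    (hb : ∀ z : ℂ, ‖z‖ = 1 → ‖p.eval z‖ ^ 2 ≤ M * exp (m * b)) {z : ℂ} (hz : 1 ≤ ‖z‖) :
    ‖p.eval z‖ ^ 2 ≤ M * exp (m * (b + log (‖z‖ ^ 2))) := by
  have hM : 0 ≤ M * exp (m * b) := (sq_nonneg _).trans (hb 1 norm_one)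
  have hwalsh := norm_eval_le_of_forall_norm_eq le_rfl one_pos
    (fun w hw => le_sqrt_of_sq_le (hb w hw)) hz
  have hpow : (‖z‖ ^ 2) ^ p.natDegree ≤ exp (m * log (‖z‖ ^ 2)) := by
    rw [← exp_log (show 0 < ‖z‖ ^ 2 by positivity), ← exp_nat_mul, log_exp]
    have := log_nonneg (one_le_pow₀ hz (n := 2))
    gcongr
  calc ‖p.eval z‖ ^ 2 ≤ (√(M * exp (m * b)) * ‖z‖ ^ p.natDegree) ^ 2 := by
        gcongr
        simpa only [div_one] using hwalsh
    _ = M * exp (m * b) * (‖z‖ ^ 2) ^ p.natDegree := by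
        rw [mul_pow, sq_sqrt hM, ← pow_mul, ← pow_mul, mul_comm 2]
    _ ≤ M * exp (m * b) * exp (m * log (‖z‖ ^ 2)) := by gcongr
    _ = M * exp (m * (b + log (‖z‖ ^ 2))) := by rw [mul_assoc, ← exp_add, ← mul_add]

theorem exists_norm_eval_sq_le_exp_equilibriumWeight {Q : ℂ → ℝ} (hQ : Continuous Q)
    (hgrowth : Tendsto (fun z => Q z - log (‖z‖ ^ 2)) (Bornology.cobounded ℂ) atTop) :
    ∃ R : ℝ, ∀ (m : ℝ) (p : ℂ[X]) (M : ℝ), 0 < m → p.natDegree ≤ m →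
      (∀ z, ‖z‖ ≤ R → ‖p.eval z‖ ^ 2 ≤ M * exp (m * Q z)) →
        ∀ z, ‖p.eval z‖ ^ 2 ≤ M * exp (m * equilibriumWeight Q z) := by
  obtain ⟨c, hc⟩ := exists_posLog_sub_le hQ hgrowth
  obtain ⟨b, hb⟩ := (isCompact_sphere (0 : ℂ) 1).bddAbove_image hQ.continuousOn
  obtain ⟨R, -, hR⟩ := (hasBasis_cobounded_norm.eventually_iff).1 (hgrowth.eventually_ge_atTop b)
  refine ⟨max R 1, fun m p M hm hdeg hp => ?_⟩
  have hM : 0 ≤ M :=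
    nonneg_of_mul_nonneg_left ((sq_nonneg _).trans (hp 0 (by simp))) (exp_pos _)
  have hunit (z : ℂ) (hz : ‖z‖ = 1) : ‖p.eval z‖ ^ 2 ≤ M * exp (m * b) :=
    (hp z (hz ▸ le_max_right _ _)).trans (by gcongr; exact hb ⟨z, by simpa using hz, rfl⟩)
  refine norm_sq_le_mul_exp_equilibriumWeight p.differentiable hm hc (fun z => ?_)
    (fun z hz => norm_eval_sq_le_mul_exp hdeg hunit hz)
  rcases le_total ‖z‖ (max R 1) with hz | hz
  · exact hp z hz
  · refine (norm_eval_sq_le_mul_exp hdeg hunit ((le_max_right _ _).trans hz)).trans ?_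
    gcongr
    linarith [hR ((le_max_left R 1).trans hz)]

end

/-! ### Averages of bianalytic functions -/

section

open ComplexConjugate Metric MeasureTheory Real Set

theorem norm_integral_mul_sq_le {α 𝕜 : Type*} [MeasurableSpace α] {μ : Measure α} [RCLike 𝕜]
    {f g : α → 𝕜} (hf : MemLp f 2 μ) (hg : MemLp g 2 μ) :
    ‖∫ x, f x * g x ∂μ‖ ^ 2 ≤ (∫ x, ‖f x‖ ^ 2 ∂μ) * ∫ x, ‖g x‖ ^ 2 ∂μ := by
  have hholder : ∫ x, ‖f x‖ * ‖g x‖ ∂μ ≤ √(∫ x, ‖f x‖ ^ 2 ∂μ) * √(∫ x, ‖g x‖ ^ 2 ∂μ) := by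
    simpa [sqrt_eq_rpow] using integral_mul_le_Lp_mul_Lq_of_nonneg (μ := μ) HolderConjugate.two_two
      (.of_forall fun x => norm_nonneg (f x)) (.of_forall fun x => norm_nonneg (g x))
      (by simpa using hf.norm) (by simpa using hg.norm)
  have hnorm : ‖∫ x, f x * g x ∂μ‖ ≤ ∫ x, ‖f x‖ * ‖g x‖ ∂μ := by
    simpa only [norm_mul] using norm_integral_le_integral_norm fun x => f x * g x
  rw [← sqrt_le_sqrt_iff (by positivity), sqrt_sq (norm_nonneg _), sqrt_mul (by positivity)]
  exact hnorm.trans hholder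

section Polar

variable {E : Type*} [NormedAddCommGroup E] [NormedSpace ℝ E]

theorem setIntegral_ball_eq_setIntegral_polarCoord (f : ℂ → E) (c : ℂ) (ρ : ℝ) :
    ∫ z in ball c ρ, f z = ∫ p in Ioo 0 ρ ×ˢ Ioo (-π) π, p.1 • f (circleMap c p.1 p.2) := by
  have htranslate : ∫ z in ball c ρ, f z
      = ∫ z, (ball (0 : ℂ) ρ).indicator (fun z => f (z + c)) z := by
    rw [← integral_indicator isOpen_ball.measurableSet, ← integral_add_right_eq_self _ c]
    congr 1
    ext z
    simp [indicator, mem_ball]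
  rw [htranslate, ← Complex.integral_comp_polarCoord_symm, ← integral_indicator
    polarCoord.open_target.measurableSet, ← integral_indicator
    (measurableSet_Ioo.prod measurableSet_Ioo)]
  congr 1
  ext ⟨r, θ⟩
  by_cases hr : 0 < r
  · have : (r * (Complex.cos θ + Complex.sin θ * Complex.I) : ℂ) + c = circleMap c r θ := by
      rw [circleMap, Complex.exp_mul_I, add_comm]
    simp [indicator, polarCoord_target, hr, abs_of_pos hr, -Complex.ofReal_cos,
      -Complex.ofReal_sin]
    split_ifs <;> simp_all
  · simp [indicator, polarCoord_target, hr]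

theorem integral_neg_pi_pi_circleMap (f : ℂ → E) (c : ℂ) (r : ℝ) :
    ∫ θ in (-π)..π, f (circleMap c r θ) = (2 * π) • circleAverage f c r := by
  have hperiodic := ((periodic_circleMap c r).comp f).intervalIntegral_add_eq (-π) 0
  rw [zero_add, show -π + 2 * π = π by ring] at hperiodic
  rw [circleAverage, smul_inv_smul₀ two_pi_pos.ne']
  exact hperiodic

theorem setIntegral_ball_eq_integral_circleAverage {f : ℂ → E} (hf : Continuous f) (c : ℂ) {ρ : ℝ}
    (hρ : 0 ≤ ρ) :
    ∫ z in ball c ρ, f z = ∫ r in 0..ρ, (2 * π * r) • circleAverage f c r := by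
  have hcont : Continuous fun p : ℝ × ℝ => p.1 • f (circleMap c p.1 p.2) :=
    continuous_fst.smul (hf.comp circleMap.continuous)
  rw [setIntegral_ball_eq_setIntegral_polarCoord, Measure.volume_eq_prod, setIntegral_prod,
    intervalIntegral.integral_of_le hρ, integral_Ioc_eq_integral_Ioo]
  · refine setIntegral_congr_fun measurableSet_Ioo fun r _ => ?_
    dsimp only
    rw [integral_smul, ← integral_Ioc_eq_integral_Ioo,
      ← intervalIntegral.integral_of_le (by linarith [pi_pos]), integral_neg_pi_pi_circleMap,
      smul_smul, mul_comm r]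
  · exact (hcont.continuousOn.integrableOn_compact ((isCompact_Icc (a := (0 : ℝ)) (b := ρ)).prod
      (isCompact_Icc (a := -π) (b := π)))).mono_set
      (prod_mono Ioo_subset_Icc_self Ioo_subset_Icc_self)

end Polar

section Bianalytic

variable {F G : ℂ → ℂ}

theorem conj_sub_mul_sub_of_mem_sphere {z c : ℂ} {r : ℝ} (hz : z ∈ sphere c |r|) :
    conj (z - c) * (z - c) = (r : ℂ) ^ 2 := by
  rw [Complex.conj_mul', mem_sphere_iff_norm.1 hz]
  exact_mod_cast sq_abs r

theorem circleAverage_conj_sub (c : ℂ) (r : ℝ) : circleAverage (fun z => conj (z - c)) c r = 0 := by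
  have hd : Differentiable ℂ fun z => z - c := by fun_prop
  have hsub : circleAverage (fun z => z - c) c r = 0 := by
    rw [hd.diffContOnCl.circleAverage, sub_self]
  have hcomm := Complex.conjCLE.toContinuousLinearMap.circleAverage_comp_comm
    (f := fun z : ℂ => z - c) (c := c) (R := r)
    (Continuous.continuousOn (by fun_prop)).circleIntegrable'
  rw [hsub, map_zero] at hcomm
  exact hcomm

theorem circleAverage_bianalytic (hF : Differentiable ℂ F) (hG : Differentiable ℂ G) (c : ℂ)
    (r : ℝ) :
    circleAverage (fun z => F z + conj (z - c) * G z) c r = F c + r ^ 2 * deriv G c := by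
  have hslope : Differentiable ℂ (dslope G c) := by
    rw [← differentiableOn_univ] at hG ⊢
    exact (Complex.differentiableOn_dslope Filter.univ_mem).2 hG
  have hF' : Differentiable ℂ fun z => F z + (r : ℂ) ^ 2 * dslope G c z := by fun_prop
  have hconj : Continuous fun z : ℂ => G c • conj (z - c) := by fun_prop
  have hsphere : circleAverage (fun z => F z + conj (z - c) * G z) c r
      = circleAverage (fun z => (F z + (r : ℂ) ^ 2 * dslope G c z) + G c • conj (z - c)) c r := by
    refine circleAverage_congr_sphere fun z hz => ?_
    have h := sub_smul_dslope G c z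
    rw [smul_eq_mul] at h
    simp only [← conj_sub_mul_sub_of_mem_sphere hz, smul_eq_mul]
    linear_combination -(conj (z - c)) * h
  rw [hsphere, circleAverage_fun_add hF'.continuous.continuousOn.circleIntegrable'
    hconj.continuousOn.circleIntegrable', hF'.diffContOnCl.circleAverage, circleAverage_fun_smul,
    circleAverage_conj_sub, smul_zero, add_zero, dslope_same]

theorem circleAverage_sub_mul_bianalytic (hF : Differentiable ℂ F) (hG : Differentiable ℂ G)
    (c : ℂ) (r : ℝ) :
    circleAverage (fun z => (z - c) * (F z + conj (z - c) * G z)) c r = r ^ 2 * G c := by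
  have hd : Differentiable ℂ fun z => (z - c) * F z + (r : ℂ) ^ 2 * G z := by fun_prop
  have hsphere : circleAverage (fun z => (z - c) * (F z + conj (z - c) * G z)) c r
      = circleAverage (fun z => (z - c) * F z + (r : ℂ) ^ 2 * G z) c r := by
    refine circleAverage_congr_sphere fun z hz => ?_
    simp only [← conj_sub_mul_sub_of_mem_sphere hz]
    ring
  rw [hsphere, hd.diffContOnCl.circleAverage]
  simp

end Bianalytic

end

/-! ### Local estimates -/

section

open ComplexConjugate Metric MeasureTheory Real Set

theorem memLp_two_restrict_ball {X E : Type*} [MetricSpace X] [ProperSpace X] [MeasurableSpace X]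
    [OpensMeasurableSpace X] [NormedAddCommGroup E] {μ : Measure X} [IsFiniteMeasureOnCompacts μ]
    {f : X → E} (hf : Continuous f) (c : X) (ρ : ℝ) : MemLp f 2 (μ.restrict (ball c ρ)) := by
  rw [memLp_two_iff_integrable_sq_norm hf.aestronglyMeasurable]
  exact ((hf.norm.pow 2).continuousOn.integrableOn_compact
    (isCompact_closedBall c ρ)).mono_set ball_subset_closedBall

theorem setIntegral_ball_norm_sub {φ : ℝ → ℝ} (hφ : Continuous φ) (c : ℂ) {ρ : ℝ} (hρ : 0 ≤ ρ) :
    ∫ z in ball c ρ, φ ‖z - c‖ = ∫ r in 0..ρ, 2 * π * r * φ r := by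
  rw [setIntegral_ball_eq_integral_circleAverage (by fun_prop) c hρ]
  refine intervalIntegral.integral_congr fun r hr => ?_
  have hr0 : 0 ≤ r := (uIcc_of_le hρ ▸ hr).1
  simp only [smul_eq_mul]
  rw [circleAverage_const_on_circle fun z hz => ?_]
  rw [mem_sphere_iff_norm.1 hz, abs_of_nonneg hr0]

section

variable {F G : ℂ → ℂ} {ρ : ℝ}

theorem setIntegral_ball_sub_mul_bianalytic (hF : Differentiable ℂ F) (hG : Differentiable ℂ G)
    (c : ℂ) (hρ : 0 ≤ ρ) :
    ∫ z in ball c ρ, (z - c) * (F z + conj (z - c) * G z) = (π * ρ ^ 4 / 2 : ℝ) * G c := by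
  have hFc := hF.continuous
  have hGc := hG.continuous
  have hradial : ∫ r in 0..ρ, 2 * π * r * r ^ 2 = π * ρ ^ 4 / 2 := by
    simp only [mul_assoc, ← pow_succ', intervalIntegral.integral_const_mul, integral_pow]
    norm_num
    ring
  rw [setIntegral_ball_eq_integral_circleAverage (by fun_prop) c hρ, ← hradial,
    ← Complex.real_smul, ← intervalIntegral.integral_smul_const]
  refine intervalIntegral.integral_congr fun r _ => ?_
  simp only [circleAverage_sub_mul_bianalytic hF hG, Complex.real_smul]
  push_cast
  ring

theorem circleAverage_radial_mul_bianalytic (φ : ℝ → ℝ) (hF : Differentiable ℂ F)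
    (hG : Differentiable ℂ G) (c : ℂ) (r : ℝ) :
    circleAverage (fun z => (φ ‖z - c‖ : ℂ) * (F z + conj (z - c) * G z)) c r
      = φ |r| * (F c + r ^ 2 * deriv G c) := by
  have hsphere : circleAverage (fun z => (φ ‖z - c‖ : ℂ) * (F z + conj (z - c) * G z)) c r
      = circleAverage (fun z => (φ |r| : ℂ) • (F z + conj (z - c) * G z)) c r := by
    refine circleAverage_congr_sphere fun z hz => ?_
    simp only [mem_sphere_iff_norm.1 hz, smul_eq_mul]
  rw [hsphere, circleAverage_fun_smul, circleAverage_bianalytic hF hG, smul_eq_mul]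

/- The radial factor `4 * ρ ^ 2 - 6 * r ^ 2` is orthogonal to `r ^ 2` for the measure `r dr` on
`[0, ρ]`, which removes the `deriv G c` term of `circleAverage_bianalytic`. -/
theorem setIntegral_ball_mul_bianalytic (hF : Differentiable ℂ F) (hG : Differentiable ℂ G)
    (c : ℂ) (hρ : 0 ≤ ρ) :
    ∫ z in ball c ρ, ((4 * ρ ^ 2 - 6 * ‖z - c‖ ^ 2 : ℝ) : ℂ) * (F z + conj (z - c) * G z)
      = (π * ρ ^ 4 : ℝ) * F c := by
  have hFc := hF.continuous
  have hGc := hG.continuous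
  have hzeroth : ∫ r in 0..ρ, (8 * π * ρ ^ 2 * r - 12 * π * r ^ 3) = π * ρ ^ 4 := by
    rw [intervalIntegral.integral_sub (Continuous.intervalIntegrable (by fun_prop) _ _)
      (Continuous.intervalIntegrable (by fun_prop) _ _)]
    simp only [intervalIntegral.integral_const_mul,
      intervalIntegral.integral_const_mul _ fun r => r, integral_pow, integral_id]
    norm_num
    ring
  have hfirst : ∫ r in 0..ρ, (8 * π * ρ ^ 2 * r ^ 3 - 12 * π * r ^ 5) = 0 := by
    rw [intervalIntegral.integral_sub (Continuous.intervalIntegrable (by fun_prop) _ _)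
      (Continuous.intervalIntegrable (by fun_prop) _ _)]
    simp only [intervalIntegral.integral_const_mul, integral_pow]
    norm_num
    ring
  have hradial (r : ℝ) : (2 * π * r) • circleAverage
      (fun z => ((4 * ρ ^ 2 - 6 * ‖z - c‖ ^ 2 : ℝ) : ℂ) * (F z + conj (z - c) * G z)) c r
      = (8 * π * ρ ^ 2 * r - 12 * π * r ^ 3) • F c
        + (8 * π * ρ ^ 2 * r ^ 3 - 12 * π * r ^ 5) • deriv G c := by
    rw [circleAverage_radial_mul_bianalytic (fun r => 4 * ρ ^ 2 - 6 * r ^ 2) hF hG]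
    simp only [Complex.real_smul, sq_abs]
    push_cast
    ring
  rw [setIntegral_ball_eq_integral_circleAverage (by fun_prop) c hρ]
  simp only [hradial]
  rw [intervalIntegral.integral_add (Continuous.intervalIntegrable (by fun_prop) _ _)
    (Continuous.intervalIntegrable (by fun_prop) _ _), intervalIntegral.integral_smul_const,
    intervalIntegral.integral_smul_const, hzeroth, hfirst, zero_smul, add_zero, Complex.real_smul]

theorem norm_sq_center_mul_le_setIntegral_ball (hF : Differentiable ℂ F) (hG : Differentiable ℂ G)
    (c : ℂ) (hρ : 0 < ρ) :
    ‖F c‖ ^ 2 * (π * ρ ^ 2) ≤ 4 * ∫ z in ball c ρ, ‖F z + conj (z - c) * G z‖ ^ 2 := by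
  have hFc := hF.continuous
  have hGc := hG.continuous
  have hweight : ∫ z in ball c ρ, ‖((4 * ρ ^ 2 - 6 * ‖z - c‖ ^ 2 : ℝ) : ℂ)‖ ^ 2
      = 4 * π * ρ ^ 6 := by
    simp only [Complex.norm_real, norm_eq_abs, sq_abs]
    rw [setIntegral_ball_norm_sub (φ := fun r => (4 * ρ ^ 2 - 6 * r ^ 2) ^ 2) (by fun_prop) c hρ.le]
    have hexpand (r : ℝ) : 2 * π * r * (4 * ρ ^ 2 - 6 * r ^ 2) ^ 2
        = 32 * π * ρ ^ 4 * r - 96 * π * ρ ^ 2 * r ^ 3 + 72 * π * r ^ 5 := by ring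
    simp only [hexpand]
    rw [intervalIntegral.integral_add (Continuous.intervalIntegrable (by fun_prop) _ _)
      (Continuous.intervalIntegrable (by fun_prop) _ _), intervalIntegral.integral_sub
      (Continuous.intervalIntegrable (by fun_prop) _ _)
      (Continuous.intervalIntegrable (by fun_prop) _ _)]
    simp only [intervalIntegral.integral_const_mul,
      intervalIntegral.integral_const_mul _ fun r => r, integral_pow, integral_id]
    norm_num
    ring
  have hcs := norm_integral_mul_sq_le
    (memLp_two_restrict_ball (μ := volume) (f := fun z => ((4 * ρ ^ 2 - 6 * ‖z - c‖ ^ 2 : ℝ) : ℂ))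
      (by fun_prop) c ρ)
    (memLp_two_restrict_ball (μ := volume) (f := fun z => F z + conj (z - c) * G z)
      (by fun_prop) c ρ)
  rw [setIntegral_ball_mul_bianalytic hF hG c hρ.le, hweight, norm_mul, Complex.norm_real,
    norm_of_nonneg (by positivity)] at hcs
  refine le_of_mul_le_mul_left (hcs.trans' (le_of_eq ?_) |>.trans_eq ?_)
    (show 0 < π * ρ ^ 6 by positivity) <;> ring

theorem norm_sq_conjCoeff_mul_le_setIntegral_ball (hF : Differentiable ℂ F)
    (hG : Differentiable ℂ G) (c : ℂ) (hρ : 0 < ρ) :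
    ‖G c‖ ^ 2 * (π * ρ ^ 4) ≤ 2 * ∫ z in ball c ρ, ‖F z + conj (z - c) * G z‖ ^ 2 := by
  have hFc := hF.continuous
  have hGc := hG.continuous
  have hweight : ∫ z in ball c ρ, ‖z - c‖ ^ 2 = π * ρ ^ 4 / 2 := by
    rw [setIntegral_ball_norm_sub (φ := fun r => r ^ 2) (by fun_prop) c hρ.le]
    simp only [mul_assoc, ← pow_succ', intervalIntegral.integral_const_mul, integral_pow]
    norm_num
    ring
  have hcs := norm_integral_mul_sq_le
    (memLp_two_restrict_ball (μ := volume) (f := fun z => z - c) (by fun_prop) c ρ)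
    (memLp_two_restrict_ball (μ := volume) (f := fun z => F z + conj (z - c) * G z)
      (by fun_prop) c ρ)
  rw [setIntegral_ball_sub_mul_bianalytic hF hG c hρ.le, hweight, norm_mul, Complex.norm_real,
    norm_of_nonneg (by positivity)] at hcs
  refine le_of_mul_le_mul_left (hcs.trans' (le_of_eq ?_) |>.trans_eq ?_)
    (show 0 < π * ρ ^ 4 / 4 by positivity) <;> ring

end

end

/-! ### Weighted local estimates -/

section

open ComplexConjugate Metric MeasureTheory Real Set

theorem exists_eq_re_mul (l : ℂ →L[ℝ] ℝ) : ∃ a : ℂ, ∀ w, l w = (a * w).re := by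
  refine ⟨l 1 - l Complex.I * Complex.I, fun w => ?_⟩
  conv_lhs => rw [← Complex.re_add_im w, ← mul_one (w.re : ℂ), ← Complex.real_smul,
    ← Complex.real_smul, map_add, map_smul, map_smul]
  simp only [smul_eq_mul, Complex.mul_re, Complex.sub_re, Complex.sub_im, Complex.ofReal_re,
    Complex.ofReal_im, Complex.mul_im, Complex.I_re, Complex.I_im]
  ring

variable {Q : ℂ → ℝ} {m : ℝ} {u F G : ℂ → ℂ}

theorem weightedNormSq_nonneg (Q : ℂ → ℝ) (m : ℝ) (u : ℂ → ℂ) : 0 ≤ weightedNormSq Q m u :=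
  integral_nonneg fun _ => by positivity

theorem weightedNormSq_eq_integral (hQ : Continuous Q) (m : ℝ) (u : ℂ → ℂ) :
    weightedNormSq Q m u = π⁻¹ * ∫ z, ‖u z‖ ^ 2 * exp (-(m * Q z)) := by
  rw [weightedNormSq, weightedMeasure, integral_withDensity_eq_integral_toReal_smul
    (by fun_prop) (by simp), integral_smul_measure, ENNReal.toReal_ofReal (by positivity),
    smul_eq_mul]
  congr 2
  ext z
  rw [ENNReal.toReal_ofReal (exp_pos _).le, smul_eq_mul, mul_comm]

theorem integrable_norm_sq_mul_exp (hQ : Continuous Q) (hu : MemLp u 2 (weightedMeasure Q m)) :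
    Integrable fun z => ‖u z‖ ^ 2 * exp (-(m * Q z)) := by
  have h : Integrable (fun z => ‖u z‖ ^ 2) (weightedMeasure Q m) := by
    simpa using hu.integrable_norm_pow two_ne_zero
  rw [weightedMeasure, integrable_withDensity_iff_integrable_smul' (by fun_prop) (by simp),
    integrable_smul_measure (by simpa using pi_pos) (by simp)] at h
  refine h.congr (.of_forall fun z => ?_)
  simp only [ENNReal.toReal_ofReal (exp_pos _).le, smul_eq_mul, mul_comm]

theorem setIntegral_norm_sq_le_mul_weightedNormSq (hQ : Continuous Q)
    (hu : MemLp u 2 (weightedMeasure Q m)) {v : ℂ → ℂ} (hv : Continuous v) {c : ℂ} {ρ B : ℝ}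
    (hB : 0 ≤ B) (h : ∀ z ∈ ball c ρ, ‖v z‖ ^ 2 ≤ B * (‖u z‖ ^ 2 * exp (-(m * Q z)))) :
    ∫ z in ball c ρ, ‖v z‖ ^ 2 ≤ π * (B * weightedNormSq Q m u) := by
  have hint := (integrable_norm_sq_mul_exp hQ hu).const_mul B
  have hvint : IntegrableOn (fun z => ‖v z‖ ^ 2) (ball c ρ) :=
    (memLp_two_restrict_ball hv c ρ).integrable_norm_pow two_ne_zero
  calc ∫ z in ball c ρ, ‖v z‖ ^ 2
      ≤ ∫ z in ball c ρ, B * (‖u z‖ ^ 2 * exp (-(m * Q z))) :=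
        setIntegral_mono_on hvint hint.integrableOn isOpen_ball.measurableSet h
    _ ≤ ∫ z, B * (‖u z‖ ^ 2 * exp (-(m * Q z))) :=
        setIntegral_le_integral hint (.of_forall fun z => by positivity)
    _ = π * (B * weightedNormSq Q m u) := by
        rw [integral_const_mul, weightedNormSq_eq_integral hQ, mul_left_comm,
          mul_inv_cancel_left₀ pi_ne_zero]

theorem norm_mul_cexp_sq_le {a z c : ℂ} {A ρ : ℝ} (hm : 0 ≤ m) (hA : 0 ≤ A)
    (hz : ‖z - c‖ ≤ ρ) (hQ : Q z ≤ Q c + (a * (z - c)).re + A * ‖z - c‖ ^ 2) (w : ℂ) :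
    ‖w * Complex.exp (-((m / 2 : ℝ) * (a * (z - c))))‖ ^ 2
      ≤ exp (m * (Q c + A * ρ ^ 2)) * (‖w‖ ^ 2 * exp (-(m * Q z))) := by
  have hexponent : Q z - (a * (z - c)).re ≤ Q c + A * ρ ^ 2 := by
    have : A * ‖z - c‖ ^ 2 ≤ A * ρ ^ 2 := by gcongr
    linarith
  rw [norm_mul, mul_pow, Complex.norm_exp, Complex.neg_re, Complex.re_ofReal_mul,
    ← Real.exp_nat_mul, mul_left_comm, ← Real.exp_add]
  gcongr
  push_cast
  linarith [mul_le_mul_of_nonneg_left hexponent hm]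

/- The factor in `norm_mul_cexp_sq_le` is holomorphic in `z`, so the product with a bianalytic
function is again bianalytic and the unweighted estimates apply to it. -/
theorem norm_sq_mul_le_exp_mul_weightedNormSq (hQ : Continuous Q) (hF : Differentiable ℂ F)
    (hG : Differentiable ℂ G) (hu : MemLp (fun z => F z + conj z * G z) 2 (weightedMeasure Q m))
    {a c : ℂ} {A ρ : ℝ} (hm : 0 ≤ m) (hA : 0 ≤ A) (hρ : 0 < ρ)
    (ha : ∀ z, ‖z - c‖ ≤ ρ → Q z ≤ Q c + (a * (z - c)).re + A * ‖z - c‖ ^ 2) :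
    ‖F c + conj c * G c‖ ^ 2 * ρ ^ 2 ≤ 4 * (exp (m * (Q c + A * ρ ^ 2)) *
        weightedNormSq Q m fun z => F z + conj z * G z) ∧
      ‖G c‖ ^ 2 * ρ ^ 4 ≤ 2 * (exp (m * (Q c + A * ρ ^ 2)) *
        weightedNormSq Q m fun z => F z + conj z * G z) := by
  set E : ℂ → ℂ := fun z => Complex.exp (-((m / 2 : ℝ) * (a * (z - c)))) with hE
  have hEd : Differentiable ℂ E := by fun_prop
  have hEc : E c = 1 := by simp [hE]
  have hFE : Differentiable ℂ fun z => (F z + conj c * G z) * E z := by fun_prop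
  have hGE : Differentiable ℂ fun z => G z * E z := by fun_prop
  have hFEc := hFE.continuous
  have hGEc := hGE.continuous
  have htwist (z : ℂ) : (F z + conj c * G z) * E z + conj (z - c) * (G z * E z)
      = (F z + conj z * G z) * E z := by
    rw [map_sub]
    ring
  have hint := setIntegral_norm_sq_le_mul_weightedNormSq hQ hu
    (v := fun z => (F z + conj c * G z) * E z + conj (z - c) * (G z * E z)) (by fun_prop)
    (exp_pos (m * (Q c + A * ρ ^ 2))).le fun z hz => by
      rw [htwist]
      have hzc : ‖z - c‖ ≤ ρ := (mem_ball_iff_norm.1 hz).le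
      exact norm_mul_cexp_sq_le hm hA hzc (ha z hzc) _
  have hcenter := norm_sq_center_mul_le_setIntegral_ball hFE hGE c hρ
  have hcoeff := norm_sq_conjCoeff_mul_le_setIntegral_ball hFE hGE c hρ
  simp only [hEc, mul_one] at hcenter hcoeff
  constructor <;> refine le_of_mul_le_mul_left ?_ pi_pos <;> linarith

theorem IsLocallySemiconcave.exists_norm_sq_le_of_bianalytic (hQ : IsLocallySemiconcave Q)
    (R : ℝ) :
    ∃ K, 0 < K ∧ ∀ (m : ℝ) (F G : ℂ → ℂ), 1 ≤ m → Differentiable ℂ F → Differentiable ℂ G →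
      MemLp (fun z => F z + conj z * G z) 2 (weightedMeasure Q m) → ∀ c, ‖c‖ ≤ R →
        ‖F c + conj c * G c‖ ^ 2
          ≤ K * m * weightedNormSq Q m (fun z => F z + conj z * G z) * exp (m * Q c) ∧
        ‖G c‖ ^ 2
          ≤ K * m ^ 2 * weightedNormSq Q m (fun z => F z + conj z * G z) * exp (m * Q c) := by
  obtain ⟨A, hA, hQA⟩ := hQ R
  refine ⟨4 * exp A, by positivity, fun m F G hm hF hG hu c hc => ?_⟩
  obtain ⟨l, hl⟩ := hQA c hc
  obtain ⟨a, ha⟩ := exists_eq_re_mul l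
  have hm0 : 0 < m := one_pos.trans_le hm
  have hsq : (√m)⁻¹ ^ 2 = m⁻¹ := by rw [inv_pow, sq_sqrt hm0.le]
  have hfourth : (√m)⁻¹ ^ 4 = (m ^ 2)⁻¹ := by
    rw [show 4 = 2 * 2 from rfl, pow_mul, hsq, inv_pow]
  have hradius : (√m)⁻¹ ≤ 1 := inv_le_one_of_one_le₀ (one_le_sqrt.2 hm)
  have hexp : exp (m * (Q c + A * m⁻¹)) = exp A * exp (m * Q c) := by
    rw [← Real.exp_add]
    congr 1
    field_simp
    ring
  have hbound := norm_sq_mul_le_exp_mul_weightedNormSq hQ.continuous hF hG hu hm0.le hA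
    (inv_pos.2 (sqrt_pos.2 hm0)) fun z hz => ha (z - c) ▸ hl z (hz.trans hradius)
  rw [hsq, hfourth, hexp, ← div_eq_mul_inv, ← div_eq_mul_inv, div_le_iff₀ hm0,
    div_le_iff₀ (by positivity)] at hbound
  have hN := weightedNormSq_nonneg Q m fun z => F z + conj z * G z
  refine ⟨hbound.1.trans_eq (by ring), hbound.2.trans ?_⟩
  have : 0 ≤ exp A * exp (m * Q c) * (weightedNormSq Q m fun z => F z + conj z * G z) * m ^ 2 := by
    positivity
  linarith

end

/-! ### Freezing the conjugate variable -/

section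

open ComplexConjugate MeasureTheory Polynomial Filter

theorem exists_polynomials_of_mem_Pol_two {n : ℕ} {u : ℂ → ℂ} (hu : u ∈ Pol 2 n) :
    ∃ f g : ℂ[X], f ∈ degreeLT ℂ n ∧ g ∈ degreeLT ℂ n ∧
      u = fun z => f.eval z + conj z * g.eval z := by
  induction hu using Submodule.span_induction with
  | mem u hu =>
    obtain ⟨r, hr, j, hj, rfl⟩ := hu
    have hX : (X ^ j : ℂ[X]) ∈ degreeLT ℂ n := by
      rw [mem_degreeLT, degree_X_pow]
      exact_mod_cast hj
    interval_cases r
    · exact ⟨X ^ j, 0, hX, zero_mem _, by simp⟩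
    · exact ⟨0, X ^ j, zero_mem _, hX, by simp⟩
  | zero => exact ⟨0, 0, zero_mem _, zero_mem _, by ext; simp⟩
  | add u v _ _ hu hv =>
    obtain ⟨f, g, hf, hg, rfl⟩ := hu
    obtain ⟨f', g', hf', hg', rfl⟩ := hv
    refine ⟨f + f', g + g', add_mem hf hf', add_mem hg hg', funext fun z => ?_⟩
    simp only [Pi.add_apply, eval_add]
    ring
  | smul c u _ hu =>
    obtain ⟨f, g, hf, hg, rfl⟩ := hu
    refine ⟨c • f, c • g, Submodule.smul_mem _ _ hf, Submodule.smul_mem _ _ hg,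
      funext fun z => ?_⟩
    simp only [Pi.smul_apply, eval_smul, smul_eq_mul]
    ring

/-- The polynomial obtained from the bianalytic polynomial `f + conj z * g` by freezing `conj z` at
`conj a`. It is multiplied by `(1 + conj a * z) / (1 + ‖a‖ ^ 2)`, which is `1` at `z = a`; at the
cost of one degree this cancels the growth of the frozen polynomial in `a`. -/
noncomputable def freeze (f g : ℂ[X]) (a : ℂ) : ℂ[X] :=
  C (1 + a * conj a)⁻¹ * (f + C (conj a) * g) * (C (conj a) * X + 1)

theorem one_add_mul_conj (a : ℂ) : 1 + a * conj a = ((1 + ‖a‖ ^ 2 : ℝ) : ℂ) := by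
  rw [Complex.mul_conj']
  push_cast
  rfl

theorem eval_freeze (f g : ℂ[X]) (a z : ℂ) :
    (freeze f g a).eval z
      = (1 + a * conj a)⁻¹ * (f.eval z + conj a * g.eval z) * (conj a * z + 1) := by
  simp [freeze]

theorem eval_freeze_self (f g : ℂ[X]) (a : ℂ) :
    (freeze f g a).eval a = f.eval a + conj a * g.eval a := by
  have ha : 1 + a * conj a ≠ 0 := by
    rw [one_add_mul_conj]
    exact_mod_cast (by positivity : 1 + ‖a‖ ^ 2 ≠ 0)
  rw [eval_freeze, mul_comm (conj a) a, add_comm _ (1 : ℂ), mul_right_comm, inv_mul_cancel₀ ha,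
    one_mul]

theorem natDegree_freeze_le {f g : ℂ[X]} {n : ℕ} (hf : f ∈ degreeLT ℂ n) (hg : g ∈ degreeLT ℂ n)
    (a : ℂ) : (freeze f g a).natDegree ≤ n := by
  by_cases h0 : f + C (conj a) * g = 0
  · simp [freeze, h0]
  have hsum : (f + C (conj a) * g).natDegree < n := by
    rw [natDegree_lt_iff_degree_lt h0, ← mem_degreeLT, ← smul_eq_C_mul]
    exact add_mem hf (Submodule.smul_mem _ _ hg)
  have hlinear : (C (conj a) * X + 1).natDegree ≤ 1 := by compute_degree
  refine natDegree_mul_le.trans ?_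
  have := natDegree_C_mul_le (1 + a * conj a)⁻¹ (f + C (conj a) * g)
  omega

theorem norm_eval_freeze_le {f g : ℂ[X]} {z : ℂ} {B R : ℝ} (hz : ‖z‖ ≤ R)
    (hfg : ‖f.eval z + conj z * g.eval z‖ ≤ B) (hg : ‖g.eval z‖ ≤ B) (a : ℂ) :
    ‖(freeze f g a).eval z‖ ≤ B * (2 * (1 + R) ^ 2) := by
  have hB : 0 ≤ B := (norm_nonneg _).trans hg
  have hR : 0 ≤ R := (norm_nonneg _).trans hz
  have hfrozen : ‖f.eval z + conj a * g.eval z‖ ≤ B * ((1 + R) * (1 + ‖a‖)) := by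
    calc ‖f.eval z + conj a * g.eval z‖
        = ‖(f.eval z + conj z * g.eval z) - conj z * g.eval z + conj a * g.eval z‖ := by
          congr 1
          ring
      _ ≤ ‖f.eval z + conj z * g.eval z‖ + ‖z‖ * ‖g.eval z‖ + ‖a‖ * ‖g.eval z‖ := by
          refine (norm_add_le_of_le (norm_sub_le _ _) le_rfl).trans_eq ?_
          simp only [norm_mul, RCLike.norm_conj]
      _ ≤ B + R * B + ‖a‖ * B := by gcongr
      _ ≤ B * ((1 + R) * (1 + ‖a‖)) := by nlinarith [mul_nonneg (mul_nonneg hB hR) (norm_nonneg a)]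
  have hfactor : ‖conj a * z + 1‖ ≤ (1 + R) * (1 + ‖a‖) := by
    refine (norm_add_le _ _).trans ?_
    rw [norm_mul, RCLike.norm_conj, norm_one]
    nlinarith [norm_nonneg a, mul_le_mul_of_nonneg_left hz (norm_nonneg a)]
  have hcompare : (1 + ‖a‖) ^ 2 ≤ 2 * (1 + ‖a‖ ^ 2) := by linarith [sq_nonneg (1 - ‖a‖)]
  rw [eval_freeze, one_add_mul_conj, norm_mul, norm_mul, norm_inv, Complex.norm_real,
    Real.norm_of_nonneg (by positivity), mul_assoc, inv_mul_le_iff₀ (by positivity)]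
  calc _ ≤ (B * ((1 + R) * (1 + ‖a‖))) * ((1 + R) * (1 + ‖a‖)) := by gcongr
    _ = B * (1 + R) ^ 2 * (1 + ‖a‖) ^ 2 := by ring
    _ ≤ B * (1 + R) ^ 2 * (2 * (1 + ‖a‖ ^ 2)) := by gcongr
    _ = _ := by ring

variable {Q : ℂ → ℝ}

theorem exists_norm_sq_le_of_mem_A2_two (hQ : IsLocallySemiconcave Q)
    (hgrowth : Tendsto (fun z => Q z - Real.log (‖z‖ ^ 2)) (Bornology.cobounded ℂ) atTop) :
    ∃ C, 0 < C ∧ ∀ (m : ℝ) (n : ℕ), 1 ≤ m → n ≤ m → ∀ u ∈ A2 2 Q m n, ∀ z,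
      ‖u z‖ ^ 2 ≤ C * m ^ 2 * weightedNormSq Q m u * Real.exp (m * equilibriumWeight Q z) := by
  obtain ⟨R', hextend⟩ := exists_norm_eval_sq_le_exp_equilibriumWeight hQ.continuous hgrowth
  set R := max R' 0
  obtain ⟨K, hK, hlocal⟩ := hQ.exists_norm_sq_le_of_bianalytic R
  refine ⟨K * (2 * (1 + R) ^ 2) ^ 2, by positivity, fun m n hm hn u hu a => ?_⟩
  obtain ⟨f, g, hf, hg, rfl⟩ := exists_polynomials_of_mem_Pol_two hu.1
  set N := weightedNormSq Q m fun z => f.eval z + conj z * g.eval z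
  have hN : 0 ≤ N := weightedNormSq_nonneg _ _ _
  have hdegree : ((freeze f g a).natDegree : ℝ) ≤ m :=
    le_trans (by exact_mod_cast natDegree_freeze_le hf hg a) hn
  simp only [← eval_freeze_self]
  refine hextend m _ _ (one_pos.trans_le hm) hdegree (fun z hz => ?_) a
  have hzR : ‖z‖ ≤ R := hz.trans (le_max_left _ _)
  obtain ⟨hcenter, hcoeff⟩ := hlocal m f.eval g.eval hm f.differentiable g.differentiable hu.2 z hzR
  have hB : 0 ≤ K * m ^ 2 * N * Real.exp (m * Q z) := by positivity
  have hcenter' : ‖f.eval z + conj z * g.eval z‖ ^ 2 ≤ K * m ^ 2 * N * Real.exp (m * Q z) :=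
    hcenter.trans (by gcongr; exact le_self_pow₀ hm two_ne_zero)
  have hfrozen := norm_eval_freeze_le hzR (Real.le_sqrt_of_sq_le hcenter')
    (Real.le_sqrt_of_sq_le hcoeff) a
  calc ‖(freeze f g a).eval z‖ ^ 2
      ≤ (√(K * m ^ 2 * N * Real.exp (m * Q z)) * (2 * (1 + R) ^ 2)) ^ 2 := by gcongr
    _ = K * (2 * (1 + R) ^ 2) ^ 2 * m ^ 2 * N * Real.exp (m * Q z) := by
        rw [mul_pow, Real.sq_sqrt hB]
        ring

end

/-! ### The one-point function -/

section

open ComplexConjugate MeasureTheory Filter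

section

variable {q n d : ℕ} {Q : ℂ → ℝ} {m : ℝ} {e : Fin d → ℂ → ℂ}

theorem weightedInner_self (Q : ℂ → ℝ) (m : ℝ) (u : ℂ → ℂ) :
    weightedInner Q m u u = weightedNormSq Q m u := by
  simp only [weightedInner, weightedNormSq, Complex.mul_conj', ← Complex.ofReal_pow,
    integral_complex_ofReal]

theorem IsOrthonormalBasis.weightedInner_sum_smul_left (he : IsOrthonormalBasis q Q m n e)
    (a : Fin d → ℂ) (i : Fin d) : weightedInner Q m (∑ j, a j • e j) (e i) = a i := by
  have hsum : weightedInner Q m (∑ j, a j • e j) (e i)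
      = ∑ j, a j * weightedInner Q m (e j) (e i) := by
    simp only [weightedInner, ← integral_const_mul]
    rw [← integral_finsetSum _
      fun j _ => (integrable_inner (he.mem j).2 (he.mem i).2).const_mul _]
    congr 1
    ext z
    simp [Finset.sum_mul, mul_assoc]
  simp [hsum, he.2]

theorem IsOrthonormalBasis.weightedNormSq_sum_smul (he : IsOrthonormalBasis q Q m n e)
    (a : Fin d → ℂ) : weightedNormSq Q m (∑ j, a j • e j) = ∑ j, ‖a j‖ ^ 2 := by
  set u := ∑ j, a j • e j with hu
  have humem : u ∈ A2 q Q m n :=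
    Submodule.sum_mem _ fun j _ => Submodule.smul_mem _ _ (he.mem j)
  have hparseval : weightedInner Q m u u = ∑ j, a j * conj (weightedInner Q m u (e j)) := by
    simp only [weightedInner_conj]
    simp only [weightedInner, ← integral_const_mul]
    rw [← integral_finsetSum _
      fun j _ => (integrable_inner (he.mem j).2 humem.2).const_mul _]
    congr 1
    ext z
    have hz : u z = ∑ j, a j * e j z := by simp [hu]
    calc u z * conj (u z) = (∑ j, a j * e j z) * conj (u z) := by rw [← hz]
      _ = ∑ j, a j * (e j z * conj (u z)) := by simp only [Finset.sum_mul, mul_assoc]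
  rw [weightedInner_self, hu] at hparseval
  simp only [he.weightedInner_sum_smul_left, Complex.mul_conj'] at hparseval
  exact_mod_cast hparseval

theorem sum_norm_sq_apply_le (he : IsOrthonormalBasis q Q m n e) {z : ℂ} {B : ℝ} (hB : 0 ≤ B)
    (h : ∀ u ∈ A2 q Q m n, ‖u z‖ ^ 2 ≤ B * weightedNormSq Q m u) : ∑ j, ‖e j z‖ ^ 2 ≤ B := by
  set k := ∑ j, ‖e j z‖ ^ 2
  have hk : 0 ≤ k := Finset.sum_nonneg fun j _ => by positivity
  have hz : (∑ j, conj (e j z) • e j) z = k := by simp [k, Complex.conj_mul']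
  have hsq := h (∑ j, conj (e j z) • e j)
    (Submodule.sum_mem _ fun j _ => Submodule.smul_mem _ _ (he.mem j))
  simp only [he.weightedNormSq_sum_smul, hz, Complex.norm_real, Real.norm_of_nonneg hk,
    RCLike.norm_conj, sq k] at hsq
  rcases hk.eq_or_lt with hzero | hpos
  · exact hzero ▸ hB
  · exact le_of_mul_le_mul_right hsq hpos

theorem onePointFunction_le (hQ : Continuous Q) {z : ℂ} {B : ℝ} (hB : 0 ≤ B)
    (h : ∀ u ∈ A2 q Q m n, ‖u z‖ ^ 2 ≤ B * weightedNormSq Q m u) :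
    onePointFunction q Q m n z ≤ B * Real.exp (-(m * Q z)) := by
  obtain ⟨d, e, he⟩ := exists_isOrthonormalBasis q hQ m n
  rw [onePointFunction, bergmanKernel_self he, Complex.ofReal_re]
  gcongr
  exact sum_norm_sq_apply_le he hB h

end

theorem equilibriumWeight_lt_of_notMem_droplet {Q : ℂ → ℝ} (hQ : Continuous Q)
    (hgrowth : Tendsto (fun z => Q z - Real.log (‖z‖ ^ 2)) (Bornology.cobounded ℂ) atTop) {z : ℂ}
    (hz : z ∉ droplet Q) : equilibriumWeight Q z < Q z := by
  obtain ⟨c, hc⟩ := exists_posLog_sub_le hQ hgrowth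
  exact (equilibriumWeight_le hc z).lt_of_ne fun h => hz h.symm

theorem pow_mul_exp_neg_le {x δ : ℝ} (hx : 0 ≤ x) (hδ : 0 < δ) (k : ℕ) :
    x ^ k * Real.exp (-(x * δ))
      ≤ k.factorial * (2 / δ) ^ k * Real.exp (-(δ / 2 * x)) := by
  have hpow : x ^ k ≤ k.factorial * (2 / δ) ^ k * Real.exp (δ / 2 * x) := by
    have h := Real.pow_div_factorial_le_exp (δ / 2 * x) (by positivity) k
    rw [div_le_iff₀ (by positivity)] at h
    calc x ^ k = (2 / δ) ^ k * (δ / 2 * x) ^ k := by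
          rw [← mul_pow]
          field_simp
      _ ≤ (2 / δ) ^ k * (Real.exp (δ / 2 * x) * k.factorial) := by gcongr
      _ = _ := by ring
  calc x ^ k * Real.exp (-(x * δ))
      ≤ k.factorial * (2 / δ) ^ k * Real.exp (δ / 2 * x) * Real.exp (-(x * δ)) := by gcongr
    _ = k.factorial * (2 / δ) ^ k * Real.exp (-(δ / 2 * x)) := by
        rw [mul_assoc, ← Real.exp_add]
        congr 2
        ring

end

end Polyanalytic

theorem mainTheorem8_general (Q : ℂ → ℝ) (hQ : Polyanalytic.IsLocallySemiconcave Q)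
    (hgrowth : Filter.Tendsto (fun z => Q z - Real.log (‖z‖ ^ 2))
      (Bornology.cobounded ℂ) Filter.atTop) :
    (∃ C : ℝ, 0 < C ∧ ∀ (m : ℝ) (n : ℕ), 1 ≤ m → (n : ℝ) ≤ m →
      (∀ u ∈ Polyanalytic.A2 2 Q m n, ∀ z : ℂ,
        ‖u z‖ ^ 2 ≤ C * m ^ 2 * Polyanalytic.weightedNormSq Q m u *
          Real.exp (m * Polyanalytic.equilibriumWeight Q z)) ∧
      (∀ z : ℂ, Polyanalytic.onePointFunction 2 Q m n z ≤
        C * m ^ 2 * Real.exp (-(m * (Q z - Polyanalytic.equilibriumWeight Q z))))) ∧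
    (∀ z : ℂ, z ∉ Polyanalytic.droplet Q →
      ∃ c C' : ℝ, 0 < c ∧ 0 < C' ∧ ∀ (m : ℝ) (n : ℕ), 1 ≤ m → (n : ℝ) ≤ m →
        Polyanalytic.onePointFunction 2 Q m n z ≤ C' * Real.exp (-(c * m))) := by
  obtain ⟨C, hC, hpointwise⟩ := Polyanalytic.exists_norm_sq_le_of_mem_A2_two hQ hgrowth
  have hkernel (m : ℝ) (n : ℕ) (hm : 1 ≤ m) (hn : n ≤ m) (z : ℂ) :
      Polyanalytic.onePointFunction 2 Q m n z ≤
        C * m ^ 2 * Real.exp (-(m * (Q z - Polyanalytic.equilibriumWeight Q z))) := by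
    refine (Polyanalytic.onePointFunction_le hQ.continuous
      (B := C * m ^ 2 * Real.exp (m * Polyanalytic.equilibriumWeight Q z)) (by positivity)
      fun u hu => (hpointwise m n hm hn u hu z).trans_eq (mul_right_comm _ _ _)).trans_eq ?_
    rw [mul_assoc, ← Real.exp_add, mul_sub, neg_sub, sub_eq_add_neg]
  refine ⟨⟨C, hC, fun m n hm hn => ⟨hpointwise m n hm hn, hkernel m n hm hn⟩⟩, fun z hz => ?_⟩
  have hgap :=
    sub_pos.2 (Polyanalytic.equilibriumWeight_lt_of_notMem_droplet hQ.continuous hgrowth hz)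
  refine ⟨_, C * (Nat.factorial 2 * (2 / (Q z - Polyanalytic.equilibriumWeight Q z)) ^ 2),
    half_pos hgap, by positivity, fun m n hm hn => (hkernel m n hm hn z).trans ?_⟩
  rw [mul_assoc, mul_assoc C]
  exact mul_le_mul_of_nonneg_left
    (Polyanalytic.pow_mul_exp_neg_le (zero_le_one.trans hm) hgap 2) hC.le

theorem mainTheorem8 (Q : ℂ → ℝ) (hQ : ContDiff ℝ 2 Q) (hgrowth : Polyanalytic.WeightGrowth Q) :
    (∃ C : ℝ, 0 < C ∧ ∀ (m : ℝ) (n : ℕ), 1 ≤ m → (n : ℝ) ≤ m →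
      (∀ u ∈ Polyanalytic.A2 2 Q m n, ∀ z : ℂ,
        ‖u z‖ ^ 2 ≤ C * m ^ 2 * Polyanalytic.weightedNormSq Q m u *
          Real.exp (m * Polyanalytic.equilibriumWeight Q z)) ∧
      (∀ z : ℂ, Polyanalytic.onePointFunction 2 Q m n z ≤
        C * m ^ 2 * Real.exp (-(m * (Q z - Polyanalytic.equilibriumWeight Q z))))) ∧
    (∀ z : ℂ, z ∉ Polyanalytic.droplet Q →
      ∃ c C' : ℝ, 0 < c ∧ 0 < C' ∧ ∀ (m : ℝ) (n : ℕ), 1 ≤ m → (n : ℝ) ≤ m →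
        Polyanalytic.onePointFunction 2 Q m n z ≤ C' * Real.exp (-(c * m))) :=
  mainTheorem8_general Q (Polyanalytic.isLocallySemiconcave_of_contDiff hQ)
    hgrowth.tendsto_sub_log_atTop
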